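/- Let $n\ge 2$ be an integer, let $B_1=\{x\in\mathbb{R}^n : |x|<1\}$ be the open Euclidean unit ball, and let $\Gamma\subset\mathbb{R}^n$ be a closed set with $\mathcal{H}^{n-2}(\Gamma)=0$, where $\mathcal{H}^{n-2}$ denotes $(n-2)$-dimensional Hausdorff measure ($\mathcal{H}^0$ is counting measure). Then $B_1\setminus\Gamma$ is simply connected, that is, it is non-empty and path connected, and every closed curve in it can be contracted to a point within it. -/

import Mathlib

/-!
Let `E` be a normed space of dimension `n ≥ 2` and `Γ ⊆ E` a set with `μH[n - 2] Γ = 0`. At the heart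
lies the fact that a two-parameter `C¹` family of points can be pushed off `Γ` by a generic
perturbation: given `f : ℝ × ℝ → E` and `b : ℝ × ℝ → ℝ` of class `C¹`, a vector `v` is bad, in the
sense that `f z + b z • v ∈ Γ` for some `z` in the unit square with `b z ≠ 0`, exactly when `v` lies
in the image of `{(g, z) ∈ Γ × I² | b z ≠ 0}` under the locally Lipschitz map
`(g, z) ↦ (b z)⁻¹ • (g - f z)`. Multiplying by the unit interval raises the dimension of a Hausdorff
null set by one (`hausdorffMeasure_prod_unitInterval_eq_zero`), so `Γ × I²` is `μH[n]`-null, hence so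
is the set of bad vectors (`ae_forall_add_smul_notMem`). As `μH[n]` is a Haar measure on `E`, there
are good vectors `v` arbitrarily close to `0`, and a small perturbation does not leave an open set
`U` containing `f '' I²` (`exists_forall_add_smul_mem_diff`).

Let now `U` be open and convex. Choosing `b` to vanish where the values of `f` are to be kept, one
perturbs a segment between two points of `U \ Γ` with fixed endpoints, which gives path
connectedness (`Convex.isPathConnected_diff`). For a loop at `x` in the open set `U \ Γ`, a Bernstein
approximation with the same endpoints is homotopic to the loop by a straight-line homotopy. It is
`C¹`, so the linear contraction of it to `x` can be perturbed, relative to the boundary of the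
square, to avoid `Γ` (`Convex.isSimplyConnected_diff`).
-/

section

open MeasureTheory Measure Set Filter Topology Metric
open scoped ENNReal NNReal unitInterval

/-! ### Hausdorff null sets -/

/-- The radii `r i` replace the diameters of the covering sets: unlike those they are positive, so
that one can subdivide an interval at scale `r i`. -/
theorem exists_cover_of_hausdorffMeasure_eq_zero {X : Type*} [EMetricSpace X] [MeasurableSpace X]
    [BorelSpace X] {d : ℝ} (hd : 0 < d) {A : Set X} (hA : μH[d] A = 0) {ε : ℝ≥0∞} (hε : 0 < ε)
    (hε' : ε ≠ ∞) :
    ∃ (t : ℕ → Set X) (r : ℕ → ℝ≥0), A ⊆ ⋃ i, t i ∧ (∀ i, 0 < r i ∧ (r i : ℝ≥0∞) ≤ ε) ∧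
      (∀ i, ediam (t i) ≤ r i) ∧ ∑' i, (r i : ℝ≥0∞) ^ d ≤ ε := by
  have hε2 : ε / 2 ≠ 0 := (ENNReal.half_pos hε.ne').ne'
  obtain ⟨η, hη, hηε⟩ := ENNReal.exists_pos_sum_of_countable hε2 ℕ
  rw [hausdorffMeasure_apply, ENNReal.iSup_eq_zero] at hA
  have h1 := hA ε
  rw [ENNReal.iSup_eq_zero] at h1
  have h2 : _ < ε / 2 := (h1 hε).trans_lt (pos_iff_ne_zero.2 hε2)
  simp only [iInf_lt_iff] at h2
  obtain ⟨t, hAt, htε, hsum⟩ := h2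
  have hdiam : ∀ i, ediam (t i) ≠ ∞ := fun i => ((htε i).trans_lt hε'.lt_top).ne
  lift ε to ℝ≥0 using hε'
  have hε0 : 0 < ε := by exact_mod_cast hε
  -- enlarging the diameters a little makes them positive
  let ρ : ℕ → ℝ≥0 := fun i => min ε (η i ^ (1 / d))
  have hρ : ∀ i, 0 < ρ i := fun i => lt_min hε0 (NNReal.rpow_pos (hη i))
  refine ⟨t, fun i => max (ediam (t i)).toNNReal (ρ i), hAt, fun i => ⟨?_, ?_⟩, fun i => ?_, ?_⟩
  · exact lt_max_of_lt_right (hρ i)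
  · rw [ENNReal.coe_max, ENNReal.coe_toNNReal (hdiam i)]
    exact max_le (htε i) (by exact_mod_cast min_le_left _ _)
  · rw [ENNReal.coe_max, ENNReal.coe_toNNReal (hdiam i)]
    exact le_max_left _ _
  · calc ∑' i, ((max (ediam (t i)).toNNReal (ρ i) : ℝ≥0) : ℝ≥0∞) ^ d
        ≤ ∑' i, ((⨆ _ : (t i).Nonempty, ediam (t i) ^ d) + η i) := by
          refine ENNReal.tsum_le_tsum fun i => ?_
          rw [ENNReal.coe_max, ENNReal.coe_toNNReal (hdiam i),
            (ENNReal.monotone_rpow_of_nonneg hd.le).map_max]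
          refine max_le (le_add_right ?_) (le_add_left ?_)
          · rcases (t i).eq_empty_or_nonempty with h | h
            · simp [h, hd]
            · simp [h]
          · have : ρ i ^ d ≤ η i := by
              calc ρ i ^ d ≤ (η i ^ (1 / d)) ^ d :=
                    NNReal.rpow_le_rpow (min_le_right _ _) hd.le
                _ = η i := by rw [← NNReal.rpow_mul, one_div_mul_cancel hd.ne', NNReal.rpow_one]
            rw [← ENNReal.coe_rpow_of_nonneg _ hd.le]
            exact_mod_cast this
      _ = (∑' i, ⨆ _ : (t i).Nonempty, ediam (t i) ^ d) + ∑' i, (η i : ℝ≥0∞) := ENNReal.tsum_add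
      _ ≤ ε / 2 + ε / 2 := add_le_add hsum.le hηε.le
      _ = ε := ENNReal.add_halves _

/-- If `t i` has diameter at most `r i ≤ 1`, then `t i ×ˢ I` is covered by at most `2 / r i` sets of
diameter at most `r i`, which contribute at most `2 * r i ^ d` to the sum defining `μH[d + 1]`. -/
theorem hausdorffMeasure_prod_unitInterval_eq_zero {X : Type*} [EMetricSpace X]
    [MeasurableSpace X] [BorelSpace X] {d : ℝ} (hd : 0 ≤ d) {A : Set X} (hA : μH[d] A = 0) :
    μH[d + 1] (A ×ˢ (I : Set ℝ)) = 0 := by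
  -- `μH[0]` counts points, so only the empty set is null for it
  rcases hd.eq_or_lt with rfl | hd
  · rcases A.eq_empty_or_nonempty with rfl | h
    · simp
    · have := one_le_hausdorffMeasure_zero_of_nonempty h
      simp [hA] at this
  let ε : ℕ → ℝ≥0∞ := fun k => ((k : ℝ≥0∞) + 1)⁻¹
  have hε0 : ∀ k, 0 < ε k := fun k => by simp [ε]
  have hε1 : ∀ k, ε k ≤ 1 := fun k => by simp [ε]
  have hεt : Tendsto ε atTop (𝓝 0) := by
    have := (tendsto_add_atTop_iff_nat 1).2 ENNReal.tendsto_inv_nat_nhds_zero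
    simpa [ε] using this
  choose t r hAt hr htr hsum using fun k => exists_cover_of_hausdorffMeasure_eq_zero hd hA (hε0 k)
    ((hε1 k).trans_lt ENNReal.one_lt_top).ne
  have hdiam : ∀ k (p : Σ i : ℕ, Fin (⌊1 / r k i⌋₊ + 1)),
      ediam (t k p.1 ×ˢ Icc ((p.2 : ℝ) * r k p.1) (((p.2 : ℝ) + 1) * r k p.1)) ≤ r k p.1 := by
    intro k p
    refine ediam_le fun x hx y hy => ?_
    rw [Prod.edist_eq]
    refine max_le ((edist_le_ediam_of_mem hx.1 hy.1).trans (htr k p.1)) ?_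
    refine (edist_le_ediam_of_mem hx.2 hy.2).trans ?_
    rw [Real.ediam_Icc, add_one_mul, add_sub_cancel_left, ENNReal.ofReal_coe_nnreal]
  have key := hausdorffMeasure_le_liminf_tsum (d + 1) (A ×ˢ (I : Set ℝ)) (l := atTop) ε hεt
    (ι := fun k => Σ i : ℕ, Fin (⌊1 / r k i⌋₊ + 1))
    (fun k p => t k p.1 ×ˢ Icc ((p.2 : ℝ) * r k p.1) (((p.2 : ℝ) + 1) * r k p.1)) ?_ ?_
  · refine le_antisymm (key.trans ?_) bot_le
    have hlim : Tendsto (fun k => 2 * ε k) atTop (𝓝 0) := by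
      simpa using ENNReal.Tendsto.const_mul hεt (Or.inr (by simp))
    rw [← hlim.liminf_eq]
    refine liminf_le_liminf (Eventually.of_forall fun k => ?_)
    rw [ENNReal.tsum_sigma']
    calc _ ≤ ∑' i, 2 * (r k i : ℝ≥0∞) ^ d := ENNReal.tsum_le_tsum fun i => ?_
      _ = 2 * ∑' i, (r k i : ℝ≥0∞) ^ d := ENNReal.tsum_mul_left
      _ ≤ 2 * ε k := by gcongr; exact hsum k
    have hr0 := (hr k i).1
    have hr1 : r k i ≤ 1 := by exact_mod_cast (hr k i).2.trans (hε1 k)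
    calc ∑' j : Fin (⌊1 / r k i⌋₊ + 1), ediam (t k i ×ˢ
          Icc ((j : ℝ) * r k i) (((j : ℝ) + 1) * r k i)) ^ (d + 1)
        ≤ ∑' j : Fin (⌊1 / r k i⌋₊ + 1), (r k i : ℝ≥0∞) ^ (d + 1) :=
          ENNReal.tsum_le_tsum fun j =>
            ENNReal.rpow_le_rpow (hdiam k ⟨i, j⟩) (by linarith)
      _ = (((⌊1 / r k i⌋₊ + 1 : ℕ) * r k i : ℝ≥0) : ℝ≥0∞) * (r k i : ℝ≥0∞) ^ d := by
          rw [tsum_fintype, Finset.sum_const, Finset.card_univ, Fintype.card_fin, nsmul_eq_mul,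
            ENNReal.rpow_add_of_nonneg _ _ hd.le zero_le_one, ENNReal.rpow_one]
          push_cast
          ring
      _ ≤ 2 * (r k i : ℝ≥0∞) ^ d := by
          gcongr
          have : (⌊1 / r k i⌋₊ + 1 : ℕ) * r k i ≤ 2 := by
            calc ((⌊1 / r k i⌋₊ + 1 : ℕ) : ℝ≥0) * r k i ≤ (1 / r k i + 1) * r k i := by
                  push_cast
                  gcongr
                  exact Nat.floor_le (by positivity)
              _ = 1 + r k i := by field_simp
              _ ≤ 2 := by rw [← one_add_one_eq_two]; gcongr
          exact_mod_cast this
  · exact Eventually.of_forall fun k p => (hdiam k p).trans (hr k p.1).2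
  · refine Eventually.of_forall fun k => ?_
    rintro ⟨x, s⟩ ⟨hx, hs⟩
    obtain ⟨i, hi⟩ := mem_iUnion.1 (hAt k hx)
    have hr0 : (0 : ℝ) < r k i := (hr k i).1
    have hs0 : 0 ≤ s / r k i := div_nonneg hs.1 hr0.le
    have hlt : ⌊s / r k i⌋₊ < ⌊1 / r k i⌋₊ + 1 := by
      refine Nat.lt_succ_of_le (Nat.le_floor ?_)
      rw [← NNReal.coe_le_coe]
      push_cast
      exact (Nat.floor_le hs0).trans (by gcongr; exact hs.2)
    refine mem_iUnion.2 ⟨⟨i, ⟨_, hlt⟩⟩, hi, ?_, ?_⟩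
    · exact (le_div_iff₀ hr0).1 (Nat.floor_le hs0)
    · exact ((div_lt_iff₀ hr0).1 (Nat.lt_floor_add_one _)).le

theorem hausdorffMeasure_image_eq_zero_of_locally_lipschitz {X Y : Type*} [EMetricSpace X]
    [MeasurableSpace X] [BorelSpace X] [SecondCountableTopology X] [EMetricSpace Y]
    [MeasurableSpace Y] [BorelSpace Y] {d : ℝ} (hd : 0 ≤ d) {f : X → Y} {s : Set X}
    (hf : ∀ x ∈ s, ∃ C, ∃ u ∈ 𝓝[s] x, LipschitzOnWith C f u) (hs : μH[d] s = 0) :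
    μH[d] (f '' s) = 0 := by
  choose! C u hu hf using hf
  obtain ⟨c, hcs, hc, hsc⟩ := TopologicalSpace.countable_cover_nhdsWithin hu
  have : f '' s ⊆ ⋃ x ∈ c, f '' (u x ∩ s) := by
    rintro _ ⟨y, hy, rfl⟩
    obtain ⟨x, hx, hyx⟩ := mem_iUnion₂.1 (hsc hy)
    exact mem_iUnion₂.2 ⟨x, hx, y, ⟨hyx, hy⟩, rfl⟩
  refine measure_mono_null this ((measure_biUnion_null_iff hc).2 fun x hx => ?_)
  refine le_antisymm ((((hf x (hcs hx)).mono inter_subset_left).hausdorffMeasure_image_le hd).trans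
    ?_) bot_le
  rw [measure_mono_null inter_subset_right hs, mul_zero]

/-! ### Smooth approximation of paths -/

/-- The approximating curve is a Bernstein approximation, which interpolates the endpoints. -/
theorem exists_contDiff_path_near {E : Type*} [NormedAddCommGroup E] [NormedSpace ℝ E]
    {x y : E} (p : Path x y) {δ : ℝ} (hδ : 0 < δ) :
    ∃ γ : ℝ → E, ContDiff ℝ 1 γ ∧ γ 0 = x ∧ γ 1 = y ∧ ∀ t : I, dist (γ t) (p t) < δ := by
  have hunif := bernsteinApproximation_uniform (p : C(I, E))
  obtain ⟨n, hn, hn0⟩ := ((hunif.eventually_mem (ball_mem_nhds _ hδ)).and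
    (eventually_ne_atTop 0)).exists
  let γ : ℝ → E := fun t => ∑ k : Fin (n + 1),
    (bernsteinPolynomial ℝ n k).eval t • p (bernstein.z k)
  have hγ : ∀ t : I, γ t = bernsteinApproximation n (p : C(I, E)) t := fun t => by
    rw [bernsteinApproximation.apply]
    rfl
  refine ⟨γ, ?_, ?_, ?_, fun t => ?_⟩
  · refine ContDiff.sum fun k _ => ?_
    exact (Polynomial.contDiff_aeval (bernsteinPolynomial ℝ n k) 1).smul contDiff_const
  · simpa using hγ 0
  · simpa [hn0] using hγ 1
  · rw [hγ t]
    exact (ContinuousMap.dist_apply_le_dist t).trans_lt hn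

/-! ### Pushing a two-parameter family off a null set -/

section
variable {E : Type*} [NormedAddCommGroup E] [NormedSpace ℝ E] [FiniteDimensional ℝ E]
  [MeasurableSpace E] [BorelSpace E] {Γ : Set E}

open Module

/-- The exceptional `v` lie in the image of a `μH[finrank ℝ E]`-null subset of `Γ × I × I` under the
locally Lipschitz map `(g, z) ↦ (b z)⁻¹ • (g - f z)`. -/
theorem ae_forall_add_smul_notMem (hE : 2 ≤ finrank ℝ E) (hΓ : μH[(finrank ℝ E : ℝ) - 2] Γ = 0)
    {f : ℝ × ℝ → E} {b : ℝ × ℝ → ℝ} (hf : ContDiff ℝ 1 f) (hb : ContDiff ℝ 1 b) :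
    ∀ᵐ v ∂(μH[finrank ℝ E] : Measure E), ∀ z ∈ I ×ˢ I, b z ≠ 0 → f z + b z • v ∉ Γ := by
  have := FiniteDimensional.proper_real E
  have hd : (0 : ℝ) ≤ (finrank ℝ E : ℝ) - 2 := by
    have : (2 : ℝ) ≤ finrank ℝ E := by exact_mod_cast hE
    linarith
  have h0 : μH[(finrank ℝ E : ℝ)] ((Γ ×ˢ (I : Set ℝ)) ×ˢ (I : Set ℝ)) = 0 := by
    have := hausdorffMeasure_prod_unitInterval_eq_zero (by linarith)
      (hausdorffMeasure_prod_unitInterval_eq_zero hd hΓ)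
    convert this using 3
    ring
  let S : Set ((E × ℝ) × ℝ) := ((Γ ×ˢ (I : Set ℝ)) ×ˢ (I : Set ℝ)) ∩
    {w | b (w.1.2, w.2) ≠ 0}
  let F : (E × ℝ) × ℝ → E := fun w => (b (w.1.2, w.2))⁻¹ • (w.1.1 - f (w.1.2, w.2))
  have hFS : μH[(finrank ℝ E : ℝ)] (F '' S) = 0 := by
    refine hausdorffMeasure_image_eq_zero_of_locally_lipschitz (by linarith) (fun w hw => ?_)
      (measure_mono_null inter_subset_left h0)
    have hproj : ContDiff ℝ 1 fun w : (E × ℝ) × ℝ => (w.1.2, w.2) := by fun_prop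
    have : ContDiffAt ℝ 1 F w :=
      ((hb.comp hproj).contDiffAt.inv hw.2).smul
        ((by fun_prop : ContDiff ℝ 1 fun w : (E × ℝ) × ℝ => w.1.1).sub (hf.comp hproj)).contDiffAt
    obtain ⟨K, u, hu, hK⟩ := this.exists_lipschitzOnWith
    exact ⟨K, u, mem_nhdsWithin_of_mem_nhds hu, hK⟩
  refine measure_mono_null (fun v hv => ?_) hFS
  simp only [mem_compl_iff, mem_ofPred_eq, not_forall, not_not] at hv
  obtain ⟨z, hz, hbz, hΓz⟩ := hv
  exact ⟨((f z + b z • v, z.1), z.2), ⟨⟨⟨hΓz, hz.1⟩, hz.2⟩, hbz⟩, by simp [F, hbz]⟩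

/-- Perturbation lemma: a `C¹` map of the unit square into an open set `U` can be moved off a
`μH[finrank ℝ E - 2]`-null set `Γ` within `U`, keeping its values at the zeros of `b`. -/
theorem exists_forall_add_smul_mem_diff (hE : 2 ≤ finrank ℝ E)
    (hΓ : μH[(finrank ℝ E : ℝ) - 2] Γ = 0) {U : Set E} (hU : IsOpen U)
    {f : ℝ × ℝ → E} {b : ℝ × ℝ → ℝ} (hf : ContDiff ℝ 1 f) (hb : ContDiff ℝ 1 b)
    (hfU : ∀ z ∈ I ×ˢ I, f z ∈ U) (hfΓ : ∀ z ∈ I ×ˢ I, b z = 0 → f z ∉ Γ) :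
    ∃ v : E, ∀ z ∈ I ×ˢ I, f z + b z • v ∈ U \ Γ := by
  have h1 : ∀ᶠ v in 𝓝 (0 : E), ∀ z ∈ I ×ˢ I, f z + b z • v ∈ U := by
    refine (isCompact_Icc.prod isCompact_Icc).eventually_forall_of_forall_eventually fun z hz => ?_
    have hc : Continuous fun w : E × ℝ × ℝ => f w.2 + b w.2 • w.1 :=
      (hf.continuous.comp continuous_snd).add
        ((hb.continuous.comp continuous_snd).smul continuous_fst)
    exact hc.continuousAt.eventually_mem (hU.mem_nhds (by simpa using hfU z hz))
  obtain ⟨v, hv, hvU⟩ := ((dense_of_ae (ae_forall_add_smul_notMem hE hΓ hf hb)).inter_nhds_nonempty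
    h1)
  refine ⟨v, fun z hz => ⟨hvU z hz, ?_⟩⟩
  by_cases h : b z = 0
  · simpa [h] using hfΓ z hz h
  · exact hv z hz h

/-! ### Complements in convex open sets -/

theorem Convex.isPathConnected_diff (hE : 2 ≤ finrank ℝ E)
    (hΓ : μH[(finrank ℝ E : ℝ) - 2] Γ = 0) {U : Set E} (hUc : Convex ℝ U) (hU : IsOpen U)
    (hne : U.Nonempty) : IsPathConnected (U \ Γ) := by
  rw [isPathConnected_iff]
  constructor
  · obtain ⟨x, hx⟩ := hne
    -- a generic translate of a point of `U` is off `Γ`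
    obtain ⟨v, hv⟩ := exists_forall_add_smul_mem_diff hE hΓ hU (f := fun _ => x) (b := fun _ => 1)
      contDiff_const contDiff_const (fun _ _ => hx) (by simp)
    exact ⟨_, hv (0, 0) (by simp)⟩
  · intro x hx y hy
    have hΓ' : ∀ z ∈ I ×ˢ I, z.1 * (1 - z.1) = 0 → (1 - z.1) • x + z.1 • y ∉ Γ := by
      intro z _ hz
      rcases mul_eq_zero.1 hz with h | h
      · simpa [h] using hx.2
      · have : z.1 = 1 := by linarith
        simpa [this] using hy.2
    obtain ⟨v, hv⟩ := exists_forall_add_smul_mem_diff hE hΓ hU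
      (f := fun z => (1 - z.1) • x + z.1 • y) (b := fun z => z.1 * (1 - z.1))
      (by fun_prop) (by fun_prop)
      (fun z hz => hUc hx.1 hy.1 (by linarith [hz.1.2]) hz.1.1 (by ring)) hΓ'
    exact ⟨⟨⟨fun t => (1 - (t : ℝ)) • x + (t : ℝ) • y + ((t : ℝ) * (1 - t)) • v,
      by fun_prop⟩, by simp, by simp⟩, fun t => hv (t, 0) ⟨t.2, by simp⟩⟩

theorem Convex.isSimplyConnected_diff (hE : 2 ≤ finrank ℝ E) (hΓc : IsClosed Γ)
    (hΓ : μH[(finrank ℝ E : ℝ) - 2] Γ = 0) {U : Set E} (hUc : Convex ℝ U) (hU : IsOpen U)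
    (hne : U.Nonempty) : IsSimplyConnected (U \ Γ) := by
  rw [isSimplyConnected_iff_exists_homotopy_refl_forall_mem]
  refine ⟨hUc.isPathConnected_diff hE hΓ hU hne, fun x p hp => ?_⟩
  have hx : x ∈ U \ Γ := by simpa using hp 0
  obtain ⟨δ, hδ, hδU⟩ := (isCompact_range p.continuous).exists_thickening_subset_open
    (hU.sdiff hΓc) (range_subset_iff.2 hp)
  obtain ⟨γ, hγ, hγ0, hγ1, hγp⟩ := exists_contDiff_path_near p hδ
  have hγc := hγ.continuous
  have hball : ∀ t : I, ball (p t) δ ⊆ U \ Γ := fun t =>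
    (ball_subset_thickening (mem_range_self t) δ).trans hδU
  -- the loop `q` is a `C¹` approximation of `p`, and `G` is the straight-line homotopy
  let q : Path x x := ⟨⟨fun t => γ t, by fun_prop⟩, by simpa using hγ0, by simpa using hγ1⟩
  let G : p.Homotopy q :=
    { toFun := fun w => (1 - (w.1 : ℝ)) • p w.2 + (w.1 : ℝ) • γ w.2
      continuous_toFun := by fun_prop
      map_zero_left := fun t => by simp
      map_one_left := fun t => by simp [q]
      prop' := by
        rintro s t (rfl | rfl)
        · simp [hγ0, ← add_smul]
        · simp [hγ1, ← add_smul] }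
  have hG : ∀ w, G w ∈ U \ Γ := fun w => hball w.2 <|
    convex_ball (p w.2) δ (mem_ball_self hδ) (hγp w.2) (by linarith [w.1.2.2]) w.1.2.1 (by ring)
  have hγU : ∀ t ∈ I, γ t ∈ U \ Γ := fun t ht => hball ⟨t, ht⟩ (hγp ⟨t, ht⟩)
  have hΓ' : ∀ z ∈ I ×ˢ I, (z.1 * (1 - z.1)) * (z.2 * (1 - z.2)) = 0 →
      (1 - z.1) • γ z.2 + z.1 • x ∉ Γ := by
    rintro ⟨s, t⟩ hz h
    simp only [mul_eq_zero, sub_eq_zero] at h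
    rcases h with (rfl | h) | (rfl | h)
    · simpa using (hγU t hz.2).2
    · simpa [← h] using hx.2
    · simpa [hγ0, ← add_smul] using hx.2
    · simpa [← h, hγ1, ← add_smul] using hx.2
  -- the coefficient of `v` vanishes on the boundary of the square, where the contraction of `γ`
  -- to `x` takes its values on `γ` or at `x`
  obtain ⟨v, hv⟩ := exists_forall_add_smul_mem_diff hE hΓ hU
    (f := fun z => (1 - z.1) • γ z.2 + z.1 • x)
    (b := fun z => (z.1 * (1 - z.1)) * (z.2 * (1 - z.2)))
    (by fun_prop) (by fun_prop)
    (fun z hz => hUc (hγU _ hz.2).1 hx.1 (by linarith [hz.1.2]) hz.1.1 (by ring)) hΓ'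
  let H : q.Homotopy (Path.refl x) :=
    { toFun := fun w => (1 - (w.1 : ℝ)) • γ w.2 + (w.1 : ℝ) • x +
        (((w.1 : ℝ) * (1 - w.1)) * ((w.2 : ℝ) * (1 - w.2))) • v
      continuous_toFun := by fun_prop
      map_zero_left := fun t => by simp [q]
      map_one_left := fun t => by simp
      prop' := by
        rintro s t (rfl | rfl)
        · simp [hγ0, ← add_smul]
        · simp [hγ1, ← add_smul] }
  have hH : ∀ w, H w ∈ U \ Γ := fun w => hv (w.1, w.2) ⟨w.1.2, w.2.2⟩
  refine ⟨G.trans H, fun w => ?_⟩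
  rw [Path.Homotopy.trans_apply]
  split_ifs
  · exact hG _
  · exact hH _

end

end

theorem mainTheorem10 (n : ℕ) (hn : 2 ≤ n) (Γ : Set (EuclideanSpace ℝ (Fin n)))
    (hΓ : IsClosed Γ)
    (hΓ0 : MeasureTheory.Measure.hausdorffMeasure ((n : ℝ) - 2) Γ = 0) :
    IsSimplyConnected (Metric.ball (0 : EuclideanSpace ℝ (Fin n)) 1 \ Γ) :=
  (convex_ball 0 1).isSimplyConnected_diff (by simpa using hn) hΓ (by simpa using hΓ0)
    Metric.isOpen_ball (Metric.nonempty_ball.2 one_pos)
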